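/- Let $q$ be a power of a prime and let $m\ge 2$ and $\delta$ be integers with $$2\le\delta\le\delta_{\max}=q^{\lceil m/2\rceil}-1-(q-2)[m\text{ odd}],$$ where $[m\text{ odd}]$ is $1$ if $m$ is odd and $0$ otherwise. Put $n=q^m-1$, let $\alpha$ be a primitive element of $\mathbf F_{q^m}$, and let $C=\mathcal{BCH}(n,q;\delta)$ be the primitive, narrow-sense BCH code over $\mathbf F_q$ of designed distance $\delta$, that is, the cyclic code of length $n$ with generator polynomial $\prod_{z\in Z}(x-\alpha^z)$, where $Z=C_1\cup\dots\cup C_{\delta-1}$ and $C_x=\{xq^k\bmod n\mid 0\le k<m\}$. Then $C$ contains its Euclidean dual code $C^\perp$, and the CSS construction applied to $C$ gives a quantum stabilizer code $Q\subseteq(\mathbf C^q)^{\otimes n}$, namely the joint $1$-eigenspace of the operators $X(a)$ and $Z(b)$ with $a,b\in C^\perp$, where $X(a)|x\rangle=|x+a\rangle$, $Z(b)|x\rangle=\omega^{\mathrm{tr}(b\cdot x)}|x\rangle$, $\omega=e^{2\pi i/p}$, $p$ is the characteristic of $\mathbf F_q$ and $\mathrm{tr}$ is the trace from $\mathbf F_q$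 to $\mathbf F_p$. The code $Q$ has parameters $$[[\,q^m-1,\; q^m-1-2m\lceil(\delta-1)(1-1/q)\rceil,\; d_Q\,]]_q\quad\text{with } d_Q\ge\delta,$$ and it is pure up to $\delta_{\max}+1$. If the true minimum distance $d$ of $C$ satisfies $d\le\delta_{\max}$, then $Q$ is a pure quantum code with minimum distance $d_Q=d$. Here a stabilizer code is a nonzero joint $1$-eigenspace of a subgroup of the error group $\{\omega^cX(a)Z(b)\mid a,b\in\mathbf F_q^n,\ c\in\mathbf F_p\}$; the weight of $\omega^cX(a)Z(b)$ is the number of $i$ with $(a_i,b_i)\ne(0,0)$; an $[[n,k,d_Q]]_q$ code has dimension $q^k$, and its minimum distance $d_Q$ is the least weight of an error that it does not detect; it is pure up to $t$ if no non-scalar element of the error group that fixes every vector of the code has weight less than $t$, and pure if it is pure up to its minimum distance. -/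

import Mathlib

/-! ### Classical linear codes -/

/-- The Euclidean dual code `C^⊥ = {y | x · y = 0 for all x ∈ C}`. -/
def dualCode {F : Type*} [Field F] {n : ℕ} (C : Submodule F (Fin n → F)) :
    Submodule F (Fin n → F) where
  carrier := {y | ∀ x ∈ C, x ⬝ᵥ y = 0}
  add_mem' := by
    intro y z hy hz x hx
    rw [dotProduct_add, hy x hx, hz x hx, add_zero]
  zero_mem' := by
    intro x _
    exact dotProduct_zero x
  smul_mem' := by
    intro c y hy x hx
    rw [dotProduct_smul, hy x hx, smul_zero]

/-- `d` is the (true) minimum distance of the code `C`: the least Hamming distance between two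
distinct codewords. -/
def IsMinDistance {F : Type*} [Field F] [DecidableEq F] {n : ℕ} (C : Submodule F (Fin n → F))
    (d : ℕ) : Prop :=
  IsLeast {w : ℕ | ∃ x ∈ C, ∃ y ∈ C, x ≠ y ∧ hammingDist x y = w} d

/-! ### Primitive, narrow-sense BCH codes -/

/-- The `q`-ary cyclotomic coset `{x q^k mod n | 0 ≤ k < m}` modulo `n = q^m - 1`. -/
def cyclotomicCoset (q m x : ℕ) : Finset ℕ :=
  (Finset.range m).image fun k => x * q ^ k % (q ^ m - 1)

/-- The defining set `Z = C_1 ∪ ⋯ ∪ C_{δ-1}`. -/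
def bchDefiningSet (q m δ : ℕ) : Finset ℕ :=
  (Finset.Icc 1 (δ - 1)).biUnion (cyclotomicCoset q m)

open Polynomial in
/-- The generator polynomial `∏_{z ∈ Z} (X - α^z)`, viewed over the extension field `K`. -/
noncomputable def bchGenerator {K : Type*} [Field K] (q m δ : ℕ) (α : K) : K[X] :=
  ∏ z ∈ bchDefiningSet q m δ, (X - C (α ^ z))

open Polynomial in
/-- The polynomial `c_0 + c_1 X + ⋯ + c_{n-1} X^{n-1}` of the word `c`. -/
noncomputable def wordPoly {F : Type*} [Field F] {n : ℕ} (c : Fin n → F) : F[X] :=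
  ∑ i, C (c i) * X ^ (i : ℕ)

/-- The primitive, narrow-sense BCH code over `F` of length `n = q^m - 1` (where `q = |F|`) with
designed distance `δ`, with respect to the primitive element `α` of the extension `K` of degree `m`
of `F`: the cyclic code of all words whose polynomial is a multiple of the generator polynomial.
(The generator polynomial has its coefficients in `F`, so that divisibility over `K` and over `F`
are the same.) -/
def bchCode (F : Type*) {K : Type*} [Field F] [Field K] [Algebra F K] (q m δ : ℕ) (α : K) :
    Submodule F (Fin (q ^ m - 1) → F) where
  carrier := {c | bchGenerator q m δ α ∣ (wordPoly c).map (algebraMap F K)}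
  add_mem' := by
    intro a b ha hb
    have h : wordPoly (a + b) = wordPoly a + wordPoly b := by
      simp [wordPoly, add_mul, Finset.sum_add_distrib]
    simp only [Set.mem_ofPred_eq] at *
    rw [h, Polynomial.map_add]
    exact dvd_add ha hb
  zero_mem' := by
    have h : wordPoly (0 : Fin (q ^ m - 1) → F) = 0 := by simp [wordPoly]
    simp [h]
  smul_mem' := by
    intro r a ha
    have h : wordPoly (r • a) = Polynomial.C r * wordPoly a := by
      simp [wordPoly, Finset.mul_sum, mul_assoc]
    simp only [Set.mem_ofPred_eq] at *
    rw [h, Polynomial.map_mul]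
    exact ha.mul_left _

/-- `δ_max = q^⌈m/2⌉ - 1 - (q-2)[m odd]`. (For `q, m ≥ 2` no subtraction truncates.) -/
def deltaMax (q m : ℕ) : ℕ :=
  q ^ ⌈(m : ℚ) / 2⌉₊ - 1 - if Odd m then q - 2 else 0

/-! ### Quantum stabilizer codes over qudits of dimension `q = |F|` -/

/-- The state space `(ℂ^q)^{⊗ n} = ℂ^{q^n}`, with orthonormal basis `|x⟩` indexed by
`x ∈ F^n`. -/
abbrev QuditSpace (F : Type*) [Fintype F] (n : ℕ) : Type _ :=
  EuclideanSpace ℂ (Fin n → F)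

instance ringChar_neZero (F : Type*) [Field F] [Fintype F] : NeZero (ringChar F) :=
  ⟨CharP.char_ne_zero_of_finite F (ringChar F)⟩

/-- The trace of `F` over its prime field `𝔽_p`, `p = ringChar F`. -/
noncomputable def primeTrace (F : Type*) [Field F] : F →+ ZMod (ringChar F) :=
  letI := ZMod.algebra F (ringChar F)
  (Algebra.trace (ZMod (ringChar F)) F).toAddMonoidHom

/-- The diagonal unitary operator `|x⟩ ↦ φ(x)|x⟩`. -/
noncomputable def diagOp {ι : Type*} [Fintype ι] (φ : ι → Circle) :
    EuclideanSpace ℂ ι ≃ₗᵢ[ℂ] EuclideanSpace ℂ ι where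
  toFun v := WithLp.toLp 2 fun x => (φ x : ℂ) * v x
  invFun v := WithLp.toLp 2 fun x => ((φ x)⁻¹ : Circle) * v x
  left_inv v := by ext x; simp
  right_inv v := by ext x; simp
  map_add' u v := by ext x; simp [mul_add]
  map_smul' c v := by ext x; simp [mul_left_comm]
  norm_map' v := by
    rw [EuclideanSpace.norm_eq, EuclideanSpace.norm_eq]
    congr 1
    refine Finset.sum_congr rfl fun x _ => ?_
    change ‖(φ x : ℂ) * v x‖ ^ 2 = ‖v x‖ ^ 2
    rw [norm_mul, Circle.norm_coe, one_mul]

section errors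

variable {F : Type*} [Field F] [Fintype F] {n : ℕ}

/-- The shift operator `X(a)|x⟩ = |x + a⟩`. -/
noncomputable def xOp (a : Fin n → F) : QuditSpace F n ≃ₗᵢ[ℂ] QuditSpace F n :=
  LinearIsometryEquiv.piLpCongrLeft 2 ℂ ℂ (Equiv.addRight a)

/-- The phase operator `Z(b)|x⟩ = ω^{tr(b · x)}|x⟩`, where `ω = exp(2πi/p)`. -/
noncomputable def zOp (b : Fin n → F) : QuditSpace F n ≃ₗᵢ[ℂ] QuditSpace F n :=
  diagOp fun x => ZMod.toCircle (primeTrace F (b ⬝ᵥ x))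

/-- The error operator `ω^c X(a) Z(b)`. -/
noncomputable def errorOp (c : ZMod (ringChar F)) (a b : Fin n → F) :
    QuditSpace F n ≃ₗᵢ[ℂ] QuditSpace F n :=
  diagOp (fun _ => ZMod.toCircle c) * xOp a * zOp b

/-- The weight of the error `ω^c X(a) Z(b)`: the number of tensor components that are not
scalar. -/
def errorWeight [DecidableEq F] (a b : Fin n → F) : ℕ :=
  (Finset.univ.filter fun i => a i ≠ 0 ∨ b i ≠ 0).card

theorem errorOp_apply (c : ZMod (ringChar F)) (a b x : Fin n → F) (v : QuditSpace F n) :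
    errorOp c a b v x =
      (ZMod.toCircle c : ℂ) * (ZMod.toCircle (primeTrace F (b ⬝ᵥ (x - a))) : ℂ) * v (x - a) := by
  simp [errorOp, xOp, zOp, diagOp, Equiv.piCongrLeft', mul_assoc, sub_eq_add_neg]

theorem errorOp_zero : errorOp (0 : ZMod (ringChar F)) (0 : Fin n → F) 0 = 1 := by
  ext v x
  simp [errorOp_apply]

theorem errorOp_mul (c c' : ZMod (ringChar F)) (a b a' b' : Fin n → F) :
    errorOp c a b * errorOp c' a' b' =
      errorOp (c + c' + primeTrace F (b ⬝ᵥ a')) (a + a') (b + b') := by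
  ext v x
  have h1 : b ⬝ᵥ (x - a) = b ⬝ᵥ a' + b ⬝ᵥ (x - (a + a')) := by
    rw [← dotProduct_add]; congr 1; abel
  have h2 : x - a - a' = x - (a + a') := by abel
  change errorOp c a b (errorOp c' a' b' v) x = _
  rw [errorOp_apply, errorOp_apply, errorOp_apply, h1, h2,
    add_dotProduct]
  simp only [map_add, AddChar.map_add_eq_mul, Circle.coe_mul]
  ring

/-- The error group `G_n = {ω^c X(a) Z(b) | a, b ∈ F^n, c ∈ 𝔽_p}`. -/
noncomputable def errorGroup (F : Type*) [Field F] [Fintype F] (n : ℕ) :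
    Subgroup (QuditSpace F n ≃ₗᵢ[ℂ] QuditSpace F n) where
  carrier := {E | ∃ c a b, E = errorOp c a b}
  mul_mem' := by
    rintro _ _ ⟨c, a, b, rfl⟩ ⟨c', a', b', rfl⟩
    exact ⟨_, _, _, errorOp_mul c c' a b a' b'⟩
  one_mem' := ⟨0, 0, 0, errorOp_zero.symm⟩
  inv_mem' := by
    rintro _ ⟨c, a, b, rfl⟩
    refine ⟨-c + primeTrace F (b ⬝ᵥ a), -a, -b, ?_⟩
    rw [inv_eq_iff_mul_eq_one, errorOp_mul, ← errorOp_zero]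
    congr 1 <;> simp

/-- The joint eigenspace with eigenvalue `1` of all elements of `S`. -/
def fixedSpace (S : Subgroup (QuditSpace F n ≃ₗᵢ[ℂ] QuditSpace F n)) :
    Submodule ℂ (QuditSpace F n) where
  carrier := {v | ∀ E ∈ S, E v = v}
  add_mem' := by
    intro u v hu hv E hE
    rw [map_add, hu E hE, hv E hE]
  zero_mem' := by
    intro E _
    exact map_zero E
  smul_mem' := by
    intro c v hv E hE
    rw [map_smul, hv E hE]

/-- A stabilizer code is a nonzero joint `1`-eigenspace of a subgroup of the error group. -/
def IsStabilizerCode (Q : Submodule ℂ (QuditSpace F n)) : Prop :=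
  Q ≠ ⊥ ∧ ∃ S ≤ errorGroup F n, Q = fixedSpace S

/-- The code `Q` detects the error `E`: there is a scalar `μ` with `⟨u|E|v⟩ = μ ⟨u|v⟩` for all
`u, v ∈ Q`. -/
def Detects (Q : Submodule ℂ (QuditSpace F n)) (E : QuditSpace F n ≃ₗᵢ[ℂ] QuditSpace F n) : Prop :=
  ∃ μ : ℂ, ∀ u ∈ Q, ∀ v ∈ Q, inner ℂ u (E v) = μ * inner ℂ u v

/-- `d` is the minimum distance of the quantum code `Q` (of dimension at least two): `Q` detects
all errors of weight less than `d`, but not all errors of weight `d`. -/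
def IsQuantumMinDistance [DecidableEq F] (Q : Submodule ℂ (QuditSpace F n)) (d : ℕ) : Prop :=
  IsLeast {w : ℕ | ∃ c a b, errorWeight a b = w ∧ ¬ Detects Q (errorOp c a b)} d

/-- `Q` is an `[[n, k, d]]_q` stabilizer code: a stabilizer code in `(ℂ^q)^{⊗ n}` of dimension
`q^k` with minimum distance `d`. -/
def IsStabilizerCodeWith [DecidableEq F] (Q : Submodule ℂ (QuditSpace F n)) (k d : ℕ) : Prop :=
  IsStabilizerCode Q ∧ Module.finrank ℂ Q = Fintype.card F ^ k ∧ IsQuantumMinDistance Q d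

/-- The stabilizer of `Q`: all elements of the error group that fix every vector of `Q`. -/
noncomputable def stabilizerGroup (Q : Submodule ℂ (QuditSpace F n)) :
    Subgroup (QuditSpace F n ≃ₗᵢ[ℂ] QuditSpace F n) where
  carrier := {E | E ∈ errorGroup F n ∧ ∀ v ∈ Q, E v = v}
  mul_mem' := by
    rintro E E' ⟨hE, hE1⟩ ⟨hE', hE1'⟩
    refine ⟨mul_mem hE hE', fun v hv => ?_⟩
    change E (E' v) = v
    rw [hE1' v hv, hE1 v hv]
  one_mem' := ⟨one_mem _, fun _ _ => rfl⟩
  inv_mem' := by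
    rintro E ⟨hE, hE1⟩
    refine ⟨inv_mem hE, fun v hv => ?_⟩
    change E.symm v = v
    rw [LinearIsometryEquiv.symm_apply_eq, hE1 v hv]

/-- `Q` is pure (up) to `t`: its stabilizer contains no non-scalar error operator of weight less
than `t`. -/
def PureTo [DecidableEq F] (Q : Submodule ℂ (QuditSpace F n)) (t : ℕ) : Prop :=
  ∀ c a b, errorOp c a b ∈ stabilizerGroup Q → (a ≠ 0 ∨ b ≠ 0) → t ≤ errorWeight a b

/-- `Q` is pure: it is pure to its minimum distance. -/
def IsPure [DecidableEq F] (Q : Submodule ℂ (QuditSpace F n)) : Prop :=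
  ∃ d, IsQuantumMinDistance Q d ∧ PureTo Q d

/-- `Q` is obtained by the CSS construction from the classical code `C`: the code `C` contains its
dual code, and `Q` is the joint `1`-eigenspace of the group generated by the operators `X(a)` and
`Z(b)` with `a, b ∈ C^⊥`. -/
def IsCSSCodeOf (Q : Submodule ℂ (QuditSpace F n)) (C : Submodule F (Fin n → F)) : Prop :=
  dualCode C ≤ C ∧
    Q = fixedSpace (Subgroup.closure (xOp '' (dualCode C : Set (Fin n → F)) ∪
      zOp '' (dualCode C : Set (Fin n → F))))

end errors

/-!
A word `c` over `F` has syndromes `S_z(c) = ∑ i, c_i α^{zi}`, and by Frobenius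
`S_{zq}(c) = S_z(c)^q`, so the BCH code `C` consists of the words with `S_z(c) = 0` for
`1 ≤ z < δ` (`mem_bchCode_iff`). Trace words `(Tr(β α^{wi}))_i` have explicitly known syndromes
(`syndrome_traceWord`): the `z`-th one only involves the `k` with `n ∣ w q^k + z`. They carry both
classical facts needed.

* Since `x q^k + y` is never divisible by `n` for `0 ≤ x < δ_max`, `1 ≤ y < δ_max`
  (`not_dvd_mul_pow_add`), the trace words with `w < δ_max` lie in `C`. Pairing them with a word `y`
  of `C^⊥` and using that the trace form is nondegenerate gives `S_z(y) = 0` for `0 ≤ z < δ_max`.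
  Hence `C^⊥ ≤ C`, and, by the BCH bound, nonzero words of `C^⊥` have weight greater than `δ_max`.
* The integers in `[1, δ - 1]` that are not divisible by `q` lie in distinct cyclotomic cosets
  of full size `m` (`cyclotomic_representative_unique`). Therefore the syndromes at these integers
  can be prescribed arbitrarily, by sums of trace words, and `C` has codimension
  `m ⌈(δ - 1)(1 - 1/q)⌉` (`finrank_bchCode_add`).

On the quantum side, the joint eigenspace consists of the functions supported on `C` and invariant
under `C^⊥` (`mem_fixedSpace_cssGroup`), so that it has dimension `|C / C^⊥|`. An undetected error
`X(a) Z(b)` has `a, b ∈ C`, not both in `C^⊥` (`mem_of_not_detects`), and `X(a)` is undetected for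
every `a ∈ C` outside `C^⊥` (`not_detects_errorOp`), for instance for the all-one word. So `d_Q` is
at least the minimum distance `d` of `C`, with equality if `d ≤ δ_max`, as then the words of weight
`d` of `C` are too light to lie in `C^⊥`.
-/

/-! ### Arithmetic of cyclotomic cosets modulo `q ^ m - 1` -/

theorem ceil_half_eq (m : ℕ) : ⌈(m : ℚ) / 2⌉₊ = (m + 1) / 2 := by
  rcases Nat.even_or_odd' m with ⟨c, rfl | rfl⟩
  · have h : ((2 * c : ℕ) : ℚ) / 2 = (c : ℕ) := by push_cast; ring
    rw [h, Nat.ceil_natCast]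
    omega
  · have h : ((2 * c + 1 : ℕ) : ℚ) / 2 = 1 / 2 + (c : ℕ) := by push_cast; ring
    rw [h, Nat.ceil_add_natCast (by norm_num),
      show ⌈(1 / 2 : ℚ)⌉₊ = 1 by norm_num [Nat.ceil_eq_iff]]
    omega

theorem deltaMax_le (q m : ℕ) : deltaMax q m ≤ q ^ ((m + 1) / 2) - 1 := by
  rw [deltaMax, ceil_half_eq]
  exact Nat.sub_le _ _

theorem mul_pow_modEq {q m n : ℕ} (hn : n = q ^ m - 1) (hq : 1 ≤ q) {k : ℕ} (hk : k ≤ m) (x : ℕ) :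
    x * q ^ k * q ^ (m - k) ≡ x [MOD n] := by
  have h1 : 1 ≤ q ^ m := Nat.one_le_pow _ _ hq
  have h : x * q ^ k * q ^ (m - k) = x + n * x := by
    rw [mul_assoc, ← pow_add, Nat.add_sub_cancel' hk, hn]
    obtain ⟨t, ht⟩ := Nat.exists_eq_add_of_le h1
    rw [ht, Nat.add_sub_cancel_left]
    ring
  rw [h]
  exact (Nat.modEq_zero_iff_dvd.2 (dvd_mul_right n x)).add_left x

/-- As long as `x` has at most `m - k` digits in base `q`, multiplication by `q ^ k` modulo
`q ^ m - 1` does not wrap around. -/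
theorem eq_mul_pow_of_modEq {q m h k x y : ℕ} (hq : 2 ≤ q) (hk : 1 ≤ k) (hkm : k + h ≤ m)
    (hx : x < q ^ h) (hy : y < q ^ m - 1) (hxy : x * q ^ k ≡ y [MOD q ^ m - 1]) :
    x * q ^ k = y := by
  refine Nat.ModEq.eq_of_lt_of_lt hxy ?_ hy
  have h1 : (x + 1) * q ^ k ≤ q ^ m := calc
    (x + 1) * q ^ k ≤ q ^ h * q ^ k := Nat.mul_le_mul_right _ hx
    _ = q ^ (k + h) := by rw [← pow_add, add_comm]
    _ ≤ q ^ m := Nat.pow_le_pow_right (by omega) hkm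
  have h2 : 2 ≤ q ^ k := hq.trans (Nat.le_self_pow (by omega) q)
  rw [add_mul] at h1
  omega

theorem pow_half_lt {q m : ℕ} (hq : 2 ≤ q) (hm : 2 ≤ m) : q ^ ((m + 1) / 2) ≤ q ^ m - 1 := by
  have : q ^ ((m + 1) / 2) < q ^ m := Nat.pow_lt_pow_right (by omega) (by omega)
  omega

/-- Below `q ^ ⌈m / 2⌉`, integers not divisible by `q` lie in pairwise distinct cyclotomic cosets,
each of which has `m` elements. -/
theorem cyclotomic_representative_unique {q m x y k : ℕ} (hq : 2 ≤ q) (hm : 2 ≤ m)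
    (hx : x < q ^ ((m + 1) / 2)) (hy : y < q ^ ((m + 1) / 2)) (hqx : ¬ q ∣ x) (hqy : ¬ q ∣ y)
    (hk : k < m) (hxy : x * q ^ k ≡ y [MOD q ^ m - 1]) : k = 0 ∧ x = y := by
  have hlt := pow_half_lt hq hm
  rcases Nat.eq_zero_or_pos k with rfl | hk0
  · rw [pow_zero, mul_one] at hxy
    exact ⟨rfl, hxy.eq_of_lt_of_lt (hx.trans_le hlt) (hy.trans_le hlt)⟩
  exfalso
  by_cases hkm : k + (m + 1) / 2 ≤ m
  · have h := eq_mul_pow_of_modEq hq hk0 hkm hx (hy.trans_le hlt) hxy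
    exact hqy (h ▸ (dvd_pow_self q (by omega)).mul_left x)
  · have h := eq_mul_pow_of_modEq (k := m - k) hq (by omega) (by omega) hy (hx.trans_le hlt)
      ((hxy.mul_right _).symm.trans (mul_pow_modEq rfl (by omega) hk.le x))
    exact hqx (h ▸ (dvd_pow_self q (by omega)).mul_left y)

/-- The size bound on `δ_max` is what keeps `x q ^ k + y` strictly between `0` and `q ^ m - 1` for
`k ≤ m / 2`. -/
theorem mul_pow_add_lt {q m x y k : ℕ} (hq : 2 ≤ q) (hm : 2 ≤ m)
    (hx : x < deltaMax q m) (hy : y < deltaMax q m) (hk : 2 * k ≤ m) :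
    x * q ^ k + y < q ^ m - 1 := by
  rw [deltaMax, ceil_half_eq] at hx hy
  rcases Nat.even_or_odd' m with ⟨h, rfl | rfl⟩
  · have hodd : ¬ Odd (2 * h) := by simp
    rw [if_neg hodd, show (2 * h + 1) / 2 = h by omega] at hx hy
    have h1 : q ^ k ≤ q ^ h := Nat.pow_le_pow_right (by omega) (by omega)
    have h2 : q ^ (2 * h) = q ^ h * q ^ h := by ring
    rw [h2]
    have h3 : x * q ^ k ≤ x * q ^ h := Nat.mul_le_mul_left _ h1
    have h4 : (x + 2) * q ^ h ≤ q ^ h * q ^ h := Nat.mul_le_mul_right _ (by omega)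
    rw [add_mul] at h4
    omega
  · have hodd : Odd (2 * h + 1) := by simp
    rw [if_pos hodd, show (2 * h + 1 + 1) / 2 = h + 1 by omega] at hx hy
    have h1 : q ^ k ≤ q ^ h := Nat.pow_le_pow_right (by omega) (by omega)
    have h2 : q ^ (2 * h + 1) = q ^ (h + 1) * q ^ h := by ring
    have h5 : q ^ (h + 1) = q * q ^ h := by ring
    rw [h2]
    have h3 : x * q ^ k ≤ x * q ^ h := Nat.mul_le_mul_left _ h1
    have h4 : (x + q) * q ^ h ≤ q ^ (h + 1) * q ^ h := Nat.mul_le_mul_right _ (by omega)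
    rw [add_mul] at h4
    omega

/-- The defining set `Z` of designed distance `δ_max` is disjoint from `-Z`. -/
theorem not_dvd_mul_pow_add {q m x y k : ℕ} (hq : 2 ≤ q) (hm : 2 ≤ m)
    (hx : x < deltaMax q m) (hy : y < deltaMax q m) (hy0 : 1 ≤ y) (hk : k ≤ m) :
    ¬ q ^ m - 1 ∣ x * q ^ k + y := by
  intro h
  by_cases hkm : 2 * k ≤ m
  · exact (Nat.le_of_dvd (by omega) h).not_gt (mul_pow_add_lt hq hm hx hy hkm)
  · have h1 : (q ^ m - 1) ∣ y * q ^ (m - k) + x := by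
      rw [← Nat.modEq_zero_iff_dvd] at h ⊢
      have h2 := h.mul_right (q ^ (m - k))
      rw [zero_mul, add_mul] at h2
      rw [add_comm]
      exact ((mul_pow_modEq rfl (by omega) hk x).symm.add_right _).trans h2
    have h3 : 0 < y * q ^ (m - k) := Nat.mul_pos hy0 (Nat.pow_pos (by omega))
    exact (Nat.le_of_dvd (by omega) h1).not_gt (mul_pow_add_lt hq hm hy hx (by omega))

/-- The number of integers in `[1, δ - 1]` that are not divisible by `q`. -/
theorem card_filter_not_dvd {q δ : ℕ} (hδ : 1 ≤ δ) :
    (((Finset.Icc 1 (δ - 1)).filter fun x => ¬ q ∣ x).card : ℤ) =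
      ⌈((δ : ℚ) - 1) * (1 - 1 / (q : ℚ))⌉ := by
  have h1 : ((Finset.Icc 1 (δ - 1)).filter (q ∣ ·)).card = (δ - 1) / q := by
    rw [← Nat.Ioc_filter_dvd_card_eq_div]
    rfl
  have h2 := Finset.card_filter_add_card_filter_not (s := Finset.Icc 1 (δ - 1)) (q ∣ ·)
  rw [h1, Nat.card_Icc, Nat.add_sub_cancel] at h2
  have h3 : ((δ : ℚ) - 1) * (1 - 1 / (q : ℚ)) =
      -(((δ - 1 : ℕ) : ℚ) / (q : ℕ)) + ((δ - 1 : ℕ) : ℤ) := by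
    push_cast [hδ]
    ring
  rw [h3, Int.ceil_add_intCast, Int.ceil_neg, Rat.floor_natCast_div_natCast]
  omega

/-! ### Linear codes, their duals, and the BCH bound -/

theorem mem_dualCode {F : Type*} [Field F] {n : ℕ} {C : Submodule F (Fin n → F)} {y : Fin n → F} :
    y ∈ dualCode C ↔ ∀ x ∈ C, x ⬝ᵥ y = 0 := Iff.rfl

theorem finrank_add_finrank_dualCode {F : Type*} [Field F] {n : ℕ} (C : Submodule F (Fin n → F)) :
    Module.finrank F C + Module.finrank F (dualCode C) = n := by
  have h : dualCode C = C.dualAnnihilator.comap (dotProductEquiv F (Fin n)).toLinearMap := by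
    ext y
    simp [mem_dualCode, Submodule.mem_dualAnnihilator, dotProduct_comm y]
  have h2 : Module.finrank F (dualCode C) = Module.finrank F C.dualAnnihilator := by
    rw [h, ← LinearEquiv.finrank_eq
      (((dotProductEquiv F (Fin n)).ofSubmodule' C.dualAnnihilator))]
  rw [h2, Subspace.finrank_add_finrank_dualAnnihilator_eq, Module.finrank_fin_fun]

theorem dualCode_dualCode {F : Type*} [Field F] {n : ℕ} (C : Submodule F (Fin n → F)) :
    dualCode (dualCode C) = C := by
  symm
  apply Submodule.eq_of_le_of_finrank_eq
  · intro x hx y hy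
    rw [dotProduct_comm]
    exact hy x hx
  · have h1 := finrank_add_finrank_dualCode C
    have h2 := finrank_add_finrank_dualCode (dualCode C)
    omega

theorem eq_zero_of_forall_trace_mul_eq_zero {F K : Type*} [Field F] [Field K] [Algebra F K]
    [FiniteDimensional F K] [Algebra.IsSeparable F K] {x : K}
    (h : ∀ y, Algebra.trace F K (x * y) = 0) : x = 0 :=
  (traceForm_nondegenerate F K).1 x h

theorem eq_zero_of_forall_primeTrace_mul_eq_zero {F : Type*} [Field F] [Finite F] {x : F}
    (h : ∀ y, primeTrace F (x * y) = 0) : x = 0 := by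
  let := ZMod.algebra F (ringChar F)
  by_contra hx
  obtain ⟨y, hy⟩ := FiniteField.trace_to_zmod_nondegenerate F hx
  exact hy (h y)

/-- For linear codes, orthogonality with respect to the trace pairing is the same as orthogonality
with respect to the dot product. -/
theorem mem_dualCode_iff_primeTrace {F : Type*} [Field F] [Finite F] {n : ℕ}
    {C : Submodule F (Fin n → F)} {y : Fin n → F} :
    y ∈ dualCode C ↔ ∀ x ∈ C, primeTrace F (x ⬝ᵥ y) = 0 := by
  refine ⟨fun h x hx => by rw [h x hx, map_zero], fun h x hx => ?_⟩
  refine eq_zero_of_forall_primeTrace_mul_eq_zero fun c => ?_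
  have := h (c • x) (C.smul_mem c hx)
  rwa [smul_dotProduct, smul_eq_mul, mul_comm] at this

open Polynomial in
/-- The BCH bound: a nonzero word whose first `t` power sums vanish at distinct locators has weight
greater than `t`. Otherwise some polynomial of degree less than `t` vanishes at all but one of the
locators in the support of the word, and pairing the word with it isolates one coordinate. -/
theorem lt_hammingNorm_of_sum_mul_pow_eq_zero {K : Type*} [Field K] [DecidableEq K] {n t : ℕ}
    {c γ : Fin n → K} (hγ : Function.Injective γ) (hc : c ≠ 0)
    (h : ∀ j < t, ∑ i, c i * γ i ^ j = 0) : t < hammingNorm c := by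
  by_contra! hle
  obtain ⟨a, ha⟩ := Function.ne_iff.1 hc
  set S : Finset (Fin n) := Finset.univ.filter fun i => c i ≠ 0 with hS
  have haS : a ∈ S := by simpa [hS] using ha
  set P : K[X] := ∏ i ∈ S.erase a, (X - C (γ i)) with hP
  have hdeg : P.natDegree < t := by
    rw [hP, natDegree_prod_of_monic _ _ fun i _ => monic_X_sub_C _]
    simp only [natDegree_X_sub_C, Finset.sum_const, smul_eq_mul, mul_one]
    rw [Finset.card_erase_of_mem haS]
    have h1 : 0 < S.card := Finset.card_pos.2 ⟨a, haS⟩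
    have h2 : S.card ≤ t := hle
    omega
  have h0 : ∑ i, c i * P.eval (γ i) = 0 := by
    simp only [eval_eq_sum_range' hdeg, Finset.mul_sum]
    rw [Finset.sum_comm]
    refine Finset.sum_eq_zero fun j hj => ?_
    rw [← mul_zero (P.coeff j), ← h j (Finset.mem_range.1 hj), Finset.mul_sum]
    exact Finset.sum_congr rfl fun i _ => by ring
  rw [Finset.sum_eq_single a] at h0
  · refine (mul_ne_zero ha ?_) h0
    rw [hP, eval_prod, Finset.prod_ne_zero_iff]
    intro i hi
    rw [eval_sub, eval_X, eval_C, sub_ne_zero]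
    exact fun hai => (Finset.mem_erase.1 hi).1 (hγ hai).symm
  · intro i _ hia
    by_cases hi : c i = 0
    · rw [hi, zero_mul]
    · rw [hP, eval_prod, Finset.prod_eq_zero (i := i), mul_zero]
      · exact Finset.mem_erase.2 ⟨hia, by simpa [hS] using hi⟩
      · simp
  · simp

/-! ### Syndromes and trace words -/

theorem IsPrimitiveRoot.sum_pow_mul {K : Type*} [Field K] {α : K} {n : ℕ}
    (hα : IsPrimitiveRoot α n) (e : ℕ) :
    ∑ i : Fin n, α ^ (e * i) = if n ∣ e then (n : K) else 0 := by
  simp only [pow_mul]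
  split_ifs with h
  · simp [(hα.pow_eq_one_iff_dvd e).2 h]
  · rw [Fin.sum_univ_eq_sum_range fun i => (α ^ e) ^ i,
      geom_sum_eq fun h1 => h ((hα.pow_eq_one_iff_dvd e).1 h1), ← pow_mul, mul_comm, pow_mul,
      hα.pow_eq_one, one_pow, sub_self, zero_div]

section syndromes

variable {F K : Type*} [Field F] [Field K] [Algebra F K] {n : ℕ}

/-- The `z`-th syndrome `∑ i, c_i α^{zi}` of the word `c`, the value at `α ^ z` of its
polynomial. -/
noncomputable def syndrome (F : Type*) {K : Type*} [Field F] [Field K] [Algebra F K] {n : ℕ}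
    (α : K) (z : ℕ) : (Fin n → F) →ₗ[F] K :=
  Fintype.linearCombination F fun i => α ^ (z * i)

theorem syndrome_apply (α : K) (z : ℕ) (c : Fin n → F) :
    syndrome F α z c = ∑ i, c i • α ^ (z * i) :=
  Fintype.linearCombination_apply _ _ _

theorem eval_map_wordPoly (α : K) (z : ℕ) (c : Fin n → F) :
    ((wordPoly c).map (algebraMap F K)).eval (α ^ z) = syndrome F α z c := by
  simp [wordPoly, syndrome_apply, Polynomial.eval_finsetSum, Polynomial.map_sum, Algebra.smul_def,
    pow_mul]

theorem syndrome_mod {α : K} (hα : IsPrimitiveRoot α n) (z : ℕ) (c : Fin n → F) :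
    syndrome F α (z % n) c = syndrome F α z c := by
  have h : α ^ (z % n) = α ^ z := by rw [hα.eq_orderOf, pow_mod_orderOf]
  simp only [syndrome_apply, pow_mul, h]

theorem syndrome_mul_card_pow [Fintype F] (α : K) (z k : ℕ) (c : Fin n → F) :
    syndrome F α (z * Fintype.card F ^ k) c = syndrome F α z c ^ Fintype.card F ^ k := by
  induction k with
  | zero => simp
  | succ k ih =>
    rw [pow_succ, ← mul_assoc, pow_mul, ← ih, syndrome_apply, syndrome_apply]
    change _ = FiniteField.frobeniusAlgHom F K _
    simp only [map_sum, map_smul, FiniteField.frobeniusAlgHom_apply, ← pow_mul]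
    exact Finset.sum_congr rfl fun i _ => by rw [mul_right_comm]

/-- The BCH bound for words over a subfield, for `t` consecutive syndromes from the `b`-th on. -/
theorem lt_hammingNorm_of_syndrome_eq_zero [DecidableEq F] {α : K} (hα : IsPrimitiveRoot α n)
    {b t : ℕ} {c : Fin n → F} (hc : c ≠ 0) (h : ∀ z, b ≤ z → z < b + t → syndrome F α z c = 0) :
    t < hammingNorm c := by
  classical
  obtain ⟨a, ha⟩ := Function.ne_iff.1 hc
  have hα0 : α ≠ 0 := hα.ne_zero (Nat.ne_zero_of_lt a.2)
  set c' : Fin n → K := fun i => algebraMap F K (c i) * α ^ (b * i) with hc'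
  have hz : ∀ i, c' i = 0 ↔ c i = 0 := fun i => by
    simp [hc', hα0]
  have hnorm : hammingNorm c' = hammingNorm c := by
    simp only [hammingNorm, ne_eq, hz]
  rw [← hnorm]
  refine lt_hammingNorm_of_sum_mul_pow_eq_zero (γ := fun i : Fin n => α ^ (i : ℕ))
    (fun i j hij => Fin.ext (hα.pow_inj i.2 j.2 hij)) (fun h0 => ha ?_) fun j hj => ?_
  · exact (hz a).1 (congrFun h0 a)
  · rw [← h (b + j) (by omega) (by omega), syndrome_apply]
    refine Finset.sum_congr rfl fun i _ => ?_
    rw [hc', Algebra.smul_def, mul_assoc, ← pow_mul, ← pow_add]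
    congr 2
    ring

/-- The word `(Tr_{K/F}(β α^{wi}))_i`. -/
noncomputable def traceWord (F : Type*) {K : Type*} [Field F] [Field K] [Algebra F K] (n : ℕ)
    (α : K) (w : ℕ) (β : K) : Fin n → F :=
  fun i => Algebra.trace F K (α ^ (w * i) * β)

/-- Expanding the trace as a sum of Frobenius conjugates, only the conjugates with
`n ∣ w q^k + z` contribute to the `z`-th syndrome of a trace word. -/
theorem syndrome_traceWord [Fintype F] [FiniteDimensional F K] {α : K} (hα : IsPrimitiveRoot α n)
    (w z : ℕ) (β : K) :
    syndrome F α z (traceWord F n α w β) =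
      ∑ k ∈ Finset.range (Module.finrank F K),
        if n ∣ w * Fintype.card F ^ k + z then β ^ Fintype.card F ^ k * n else 0 := by
  have : Finite K := Module.finite_of_finite F
  simp only [syndrome_apply, traceWord, Algebra.smul_def, FiniteField.algebraMap_trace_eq_sum_pow,
    Finset.sum_mul, Nat.card_eq_fintype_card]
  rw [Finset.sum_comm]
  refine Finset.sum_congr rfl fun k _ => ?_
  rw [← mul_zero (β ^ Fintype.card F ^ k), ← mul_ite, ← hα.sum_pow_mul, Finset.mul_sum]
  refine Finset.sum_congr rfl fun i _ => ?_
  rw [mul_pow, ← pow_mul, mul_right_comm, mul_comm, ← pow_add]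
  congr 2
  ring

theorem trace_syndrome_mul (α : K) (z : ℕ) (c : Fin n → F) (β : K) :
    Algebra.trace F K (syndrome F α z c * β) = traceWord F n α z β ⬝ᵥ c := by
  simp only [syndrome_apply, Finset.sum_mul, map_sum, smul_mul_assoc, map_smul, dotProduct,
    traceWord, smul_eq_mul]
  exact Finset.sum_congr rfl fun i _ => mul_comm _ _

end syndromes

/-! ### Primitive, narrow-sense BCH codes -/

section bch

variable {F K : Type*} [Field F] [Fintype F] [Field K] [Algebra F K] {q m δ : ℕ}

theorem natCast_eq_neg_one (hq : Fintype.card F = q) (hm : m ≠ 0) :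
    ((q ^ m - 1 : ℕ) : K) = -1 := by
  have h : (q : K) = 0 := by
    rw [← hq, ← map_natCast (algebraMap F K), FiniteField.cast_card_eq_zero, map_zero]
  have hq0 : 1 ≤ q := hq ▸ Fintype.card_pos
  rw [Nat.cast_sub (Nat.one_le_pow _ _ hq0), Nat.cast_pow, h, zero_pow hm]
  simp

theorem mem_bchCode_iff (hq : Fintype.card F = q) (hm : m ≠ 0) {α : K}
    (hα : IsPrimitiveRoot α (q ^ m - 1)) {c : Fin (q ^ m - 1) → F} :
    c ∈ bchCode F q m δ α ↔ ∀ z ∈ Finset.Icc 1 (δ - 1), syndrome F α z c = 0 := by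
  have hn : 0 < q ^ m - 1 := by
    have : 1 < q := hq ▸ Fintype.one_lt_card
    have := Nat.one_lt_pow hm this
    omega
  have hcoset : ∀ x k, syndrome F α (x * q ^ k % (q ^ m - 1)) c = syndrome F α x c ^ q ^ k :=
    fun x k => by rw [syndrome_mod hα]; simpa only [hq] using syndrome_mul_card_pow α x k c
  have hZ : c ∈ bchCode F q m δ α ↔ ∀ z ∈ bchDefiningSet q m δ, syndrome F α z c = 0 := by
    have hroot : ∀ z, syndrome F α z c = 0 ↔ Polynomial.X - Polynomial.C (α ^ z) ∣
        (wordPoly c).map (algebraMap F K) := fun z => by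
      rw [Polynomial.dvd_iff_isRoot, Polynomial.IsRoot.def, eval_map_wordPoly]
    simp only [hroot]
    refine ⟨fun h z hz => ?_, fun h => ?_⟩
    · exact (Finset.dvd_prod_of_mem (fun z => Polynomial.X - Polynomial.C (α ^ z)) hz).trans h
    · refine Finset.prod_dvd_of_coprime (fun z hz y hy hzy => ?_)
        fun z hz => h z hz
      refine Polynomial.isCoprime_X_sub_C_of_isUnit_sub (sub_ne_zero_of_ne fun he => hzy ?_).isUnit
      have hlt : ∀ z ∈ bchDefiningSet q m δ, z < q ^ m - 1 := by
        simp only [bchDefiningSet, cyclotomicCoset, Finset.mem_biUnion, Finset.mem_image]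
        rintro _ ⟨x, _, k, _, rfl⟩
        exact Nat.mod_lt _ hn
      exact hα.pow_inj (hlt z hz) (hlt y hy) he
  rw [hZ]
  simp only [bchDefiningSet, cyclotomicCoset, Finset.mem_biUnion, Finset.mem_image]
  refine ⟨fun h x hx => ?_, ?_⟩
  · have := h _ ⟨x, hx, 0, Finset.mem_range.2 (by omega), rfl⟩
    rwa [hcoset, pow_zero, pow_one] at this
  · rintro h _ ⟨x, hx, k, _, rfl⟩
    rw [hcoset, h x hx, zero_pow (pow_ne_zero _ (hq ▸ Fintype.card_ne_zero))]

/-- The designed distance bounds the weights of the nonzero codewords from below. -/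
theorem le_hammingNorm_of_mem_bchCode [DecidableEq F] (hq : Fintype.card F = q) (hm : m ≠ 0) {α : K}
    (hα : IsPrimitiveRoot α (q ^ m - 1)) {c : Fin (q ^ m - 1) → F}
    (hc : c ∈ bchCode F q m δ α) (hc0 : c ≠ 0) : δ ≤ hammingNorm c := by
  rw [mem_bchCode_iff hq hm hα] at hc
  have := lt_hammingNorm_of_syndrome_eq_zero hα (b := 1) (t := δ - 1) hc0
    fun z hz hz' => hc z (Finset.mem_Icc.2 ⟨hz, by omega⟩)
  omega

/-- The trace words `traceWord F n α z β` belong to the BCH code when `-z` is not in its defining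
set, and pairing a word of the dual code with them shows that its `z`-th syndrome vanishes. -/
theorem syndrome_eq_zero_of_mem_dualCode [FiniteDimensional F K] (hq : Fintype.card F = q)
    (hm : 2 ≤ m) (hK : Module.finrank F K = m) {α : K} (hα : IsPrimitiveRoot α (q ^ m - 1))
    (hδ : δ ≤ deltaMax q m) {y : Fin (q ^ m - 1) → F} (hy : y ∈ dualCode (bchCode F q m δ α))
    {z : ℕ} (hz : z < deltaMax q m) : syndrome F α z y = 0 := by
  refine eq_zero_of_forall_trace_mul_eq_zero (F := F) fun β => ?_
  rw [trace_syndrome_mul]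
  refine hy _ ((mem_bchCode_iff hq (by omega) hα).2 fun z' hz' => ?_)
  rw [Finset.mem_Icc] at hz'
  rw [syndrome_traceWord hα, hK, hq]
  refine Finset.sum_eq_zero fun k hk => if_neg ?_
  exact not_dvd_mul_pow_add (hq ▸ Fintype.one_lt_card) hm hz (by omega) hz'.1
    (Finset.mem_range.1 hk).le

theorem dualCode_bchCode_le [FiniteDimensional F K] (hq : Fintype.card F = q)
    (hm : 2 ≤ m) (hK : Module.finrank F K = m) {α : K} (hα : IsPrimitiveRoot α (q ^ m - 1))
    (hδ : δ ≤ deltaMax q m) : dualCode (bchCode F q m δ α) ≤ bchCode F q m δ α := by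
  intro y hy
  refine (mem_bchCode_iff hq (by omega) hα).2 fun z hz => ?_
  rw [Finset.mem_Icc] at hz
  exact syndrome_eq_zero_of_mem_dualCode hq hm hK hα hδ hy (by omega)

/-- The dual code has the `δ_max` consecutive zeros `α ^ z`, `0 ≤ z < δ_max`. -/
theorem deltaMax_lt_hammingNorm_of_mem_dualCode [DecidableEq F] [FiniteDimensional F K]
    (hq : Fintype.card F = q) (hm : 2 ≤ m) (hK : Module.finrank F K = m) {α : K}
    (hα : IsPrimitiveRoot α (q ^ m - 1)) (hδ : δ ≤ deltaMax q m) {y : Fin (q ^ m - 1) → F}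
    (hy : y ∈ dualCode (bchCode F q m δ α)) (hy0 : y ≠ 0) : deltaMax q m < hammingNorm y :=
  lt_hammingNorm_of_syndrome_eq_zero hα (b := 0) hy0 fun _ _ hz =>
    syndrome_eq_zero_of_mem_dualCode hq hm hK hα hδ hy (by omega)

/-- The `z`-th syndrome of the all-one word vanishes unless `n ∣ z`. -/
theorem one_mem_bchCode (hq : Fintype.card F = q) (hm : 2 ≤ m) {α : K}
    (hα : IsPrimitiveRoot α (q ^ m - 1)) (hδ : δ ≤ deltaMax q m) :
    (1 : Fin (q ^ m - 1) → F) ∈ bchCode F q m δ α := by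
  refine (mem_bchCode_iff hq (by omega) hα).2 fun z hz => ?_
  rw [Finset.mem_Icc] at hz
  have h1 := pow_half_lt (q := q) (hq ▸ Fintype.one_lt_card) hm
  have h2 := deltaMax_le q m
  simp only [syndrome_apply, Pi.one_apply, one_smul, hα.sum_pow_mul]
  exact if_neg fun h => (Nat.le_of_dvd (by omega) h).not_gt (by omega)

/-- The all-one word is not orthogonal to itself, as the length is `-1` in `F`. -/
theorem one_notMem_dualCode_bchCode (hq : Fintype.card F = q) (hm : 2 ≤ m) {α : K}
    (hα : IsPrimitiveRoot α (q ^ m - 1)) (hδ : δ ≤ deltaMax q m) :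
    (1 : Fin (q ^ m - 1) → F) ∉ dualCode (bchCode F q m δ α) := by
  intro h
  have h1 := h 1 (one_mem_bchCode hq hm hα hδ)
  rw [one_dotProduct_one, Fintype.card_fin, natCast_eq_neg_one hq (by omega)] at h1
  exact neg_ne_zero.2 one_ne_zero h1

/-- A sum of trace words interpolates prescribed syndromes at the integers in `[1, δ - 1]` that are
not divisible by `q`; these syndromes determine all others, so the code has codimension `m` times
their number. -/
theorem finrank_bchCode_add [FiniteDimensional F K] (hq : Fintype.card F = q) (hm : 2 ≤ m)
    (hK : Module.finrank F K = m) {α : K} (hα : IsPrimitiveRoot α (q ^ m - 1))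
    (hδ : δ ≤ deltaMax q m) :
    Module.finrank F (bchCode F q m δ α) +
      m * ((Finset.Icc 1 (δ - 1)).filter fun x => ¬ q ∣ x).card = q ^ m - 1 := by
  have hq2 : 2 ≤ q := hq ▸ Fintype.one_lt_card
  have hhalf := pow_half_lt hq2 hm
  have hmax := deltaMax_le q m
  set R := (Finset.Icc 1 (δ - 1)).filter fun x => ¬ q ∣ x with hR
  have hmemR : ∀ x : R, (x : ℕ) < q ^ ((m + 1) / 2) ∧ ¬ q ∣ (x : ℕ) := fun x => by
    have := Finset.mem_filter.1 x.2
    rw [Finset.mem_Icc] at this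
    exact ⟨by omega, this.2⟩
  set f : (Fin (q ^ m - 1) → F) →ₗ[F] (R → K) := LinearMap.pi fun x => syndrome F α x with hf
  have hker : LinearMap.ker f = bchCode F q m δ α := by
    ext c
    rw [mem_bchCode_iff hq (by omega) hα, LinearMap.mem_ker]
    refine ⟨fun h z => ?_, fun h => ?_⟩
    · induction z using Nat.strong_induction_on with
      | _ z ih =>
        intro hz
        by_cases hqz : q ∣ z
        · obtain ⟨y, rfl⟩ := hqz
          rw [Finset.mem_Icc] at hz
          have hy0 : 0 < y := Nat.pos_of_mul_pos_left hz.1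
          have hlt : y < q * y := by nlinarith
          have h1 := syndrome_mul_card_pow α y 1 c
          rw [hq, pow_one, ih y hlt (Finset.mem_Icc.2 ⟨hy0, by omega⟩),
            zero_pow (by omega), mul_comm] at h1
          exact h1
        · exact congrFun h ⟨z, Finset.mem_filter.2 ⟨hz, hqz⟩⟩
    · ext x
      exact h x (Finset.mem_filter.1 x.2).1
  have hsurj : Function.Surjective f := by
    intro t
    -- the exponent `(n - 1) x` represents `-x` modulo `n`, and `n = -1` in `K`
    refine ⟨-∑ x : R, traceWord F _ α ((q ^ m - 1 - 1) * x) (t x), ?_⟩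
    ext x'
    simp only [hf, LinearMap.pi_apply, map_neg, map_sum, syndrome_traceWord hα, hK, hq]
    have hdvd : ∀ (x : R) (k : ℕ), q ^ m - 1 ∣ (q ^ m - 1 - 1) * x * q ^ k + x' ↔
        (x : ℕ) * q ^ k ≡ x' [MOD q ^ m - 1] := by
      intro x k
      have h1 : (q ^ m - 1 - 1) * x * q ^ k + x' + x * q ^ k = x' + (q ^ m - 1) * (x * q ^ k) := by
        obtain ⟨s, hs⟩ := Nat.exists_eq_add_of_le' ((Nat.one_le_pow _ _ (by omega)).trans hhalf)
        rw [hs, Nat.add_sub_cancel]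
        ring
      have h2 : (q ^ m - 1 - 1) * x * q ^ k + x' + x * q ^ k ≡ x' [MOD q ^ m - 1] := by
        rw [h1]
        exact (Nat.modEq_zero_iff_dvd.2 (dvd_mul_right _ _)).add_left _
      rw [← Nat.modEq_zero_iff_dvd]
      refine ⟨fun h => ?_, fun h => ?_⟩
      · have h3 := (h.add_right (x * q ^ k)).symm.trans h2
        rwa [zero_add] at h3
      · refine Nat.ModEq.add_right_cancel' (x * q ^ k) (h2.trans ?_)
        rw [zero_add]
        exact h.symm
    rw [Finset.sum_eq_single x', Finset.sum_eq_single 0]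
    · rw [if_pos ((hdvd x' 0).2 (by rw [pow_zero, mul_one])), natCast_eq_neg_one hq (by omega)]
      simp
    · intro k hk hk0
      refine if_neg fun h => hk0 ?_
      exact (cyclotomic_representative_unique hq2 hm (hmemR x').1 (hmemR x').1 (hmemR x').2
        (hmemR x').2 (Finset.mem_range.1 hk) ((hdvd x' k).1 h)).1
    · intro h
      exact absurd (Finset.mem_range.2 (Nat.zero_lt_of_lt hm)) h
    · intro x _ hx
      refine Finset.sum_eq_zero fun k hk => if_neg fun h => hx (Subtype.ext ?_)
      exact (cyclotomic_representative_unique hq2 hm (hmemR x).1 (hmemR x').1 (hmemR x).2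
        (hmemR x').2 (Finset.mem_range.1 hk) ((hdvd x k).1 h)).2
    · intro h
      exact absurd (Finset.mem_univ _) h
  have h := LinearMap.finrank_range_add_finrank_ker f
  rw [LinearMap.range_eq_top.2 hsurj, finrank_top, hker, Module.finrank_pi_fintype,
    Module.finrank_fin_fun] at h
  simp only [hK, Finset.sum_const, Finset.card_univ, Fintype.card_coe, smul_eq_mul] at h
  linarith

end bch

/-! ### The CSS construction -/

theorem hammingNorm_le_errorWeight_left {F : Type*} [Field F] [DecidableEq F] {n : ℕ}
    (a b : Fin n → F) : hammingNorm a ≤ errorWeight a b :=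
  Finset.card_le_card (Finset.monotone_filter_right _ fun _ _ => Or.inl)

theorem hammingNorm_le_errorWeight_right {F : Type*} [Field F] [DecidableEq F] {n : ℕ}
    (a b : Fin n → F) : hammingNorm b ≤ errorWeight a b :=
  Finset.card_le_card (Finset.monotone_filter_right _ fun _ _ => Or.inr)

theorem errorWeight_zero_right {F : Type*} [Field F] [DecidableEq F] {n : ℕ} (a : Fin n → F) :
    errorWeight a 0 = hammingNorm a := by
  simp [errorWeight, hammingNorm]

theorem le_errorWeight {F : Type*} [Field F] [DecidableEq F] {n : ℕ}
    {C : Submodule F (Fin n → F)} {t : ℕ}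
    (ht : ∀ x ∈ C, x ≠ 0 → t ≤ hammingNorm x) {a b : Fin n → F} (ha : a ∈ C) (hb : b ∈ C)
    (hab : a ≠ 0 ∨ b ≠ 0) : t ≤ errorWeight a b := by
  rcases hab with h | h
  · exact (ht a ha h).trans (hammingNorm_le_errorWeight_left a b)
  · exact (ht b hb h).trans (hammingNorm_le_errorWeight_right a b)

section css

variable {F : Type*} [Field F] [Fintype F] {n : ℕ}

theorem errorOp_eq_xOp (a : Fin n → F) : errorOp 0 a 0 = xOp a := by
  ext v x
  simp [errorOp_apply, xOp, Equiv.piCongrLeft', sub_eq_add_neg]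

theorem errorOp_eq_zOp (b : Fin n → F) : errorOp 0 0 b = zOp b := by
  ext v x
  simp [errorOp_apply, zOp, diagOp]

theorem xOp_apply (a : Fin n → F) (v : QuditSpace F n) (x : Fin n → F) :
    xOp a v x = v (x - a) := by
  simp [← errorOp_eq_xOp, errorOp_apply]

theorem zOp_apply (b : Fin n → F) (v : QuditSpace F n) (x : Fin n → F) :
    zOp b v x = ZMod.toCircle (primeTrace F (b ⬝ᵥ x)) * v x := by
  simp [← errorOp_eq_zOp, errorOp_apply]

theorem coe_toCircle_eq_one_iff {N : ℕ} [NeZero N] {c : ZMod N} :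
    (ZMod.toCircle c : ℂ) = 1 ↔ c = 0 := by
  rw [Circle.coe_eq_one, ← AddChar.map_zero_eq_one (ZMod.toCircle (N := N)),
    ZMod.injective_toCircle.eq_iff]

/-- The group generated by the operators `X(a)` and `Z(b)` with `a, b ∈ C^⊥`. -/
noncomputable def cssGroup (C : Submodule F (Fin n → F)) :
    Subgroup (QuditSpace F n ≃ₗᵢ[ℂ] QuditSpace F n) :=
  Subgroup.closure (xOp '' (dualCode C : Set (Fin n → F)) ∪
    zOp '' (dualCode C : Set (Fin n → F)))

theorem cssGroup_le_errorGroup (C : Submodule F (Fin n → F)) : cssGroup C ≤ errorGroup F n := by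
  refine (Subgroup.closure_le _).2 ?_
  rintro _ (⟨a, _, rfl⟩ | ⟨b, _, rfl⟩)
  · exact ⟨0, a, 0, (errorOp_eq_xOp a).symm⟩
  · exact ⟨0, 0, b, (errorOp_eq_zOp b).symm⟩

/-- The code space of the CSS construction consists of the states that are supported on `C` and
invariant under translation by `C^⊥`. -/
theorem mem_fixedSpace_cssGroup {C : Submodule F (Fin n → F)} {v : QuditSpace F n} :
    v ∈ fixedSpace (cssGroup C) ↔
      (∀ a ∈ dualCode C, ∀ x, v (x + a) = v x) ∧ ∀ x ∉ C, v x = 0 := by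
  have h1 : v ∈ fixedSpace (cssGroup C) ↔
      (∀ a ∈ dualCode C, xOp a v = v) ∧ ∀ b ∈ dualCode C, zOp b v = v := by
    refine ⟨fun h => ⟨fun a ha => h _ ?_, fun b hb => h _ ?_⟩, fun h E hE => ?_⟩
    · exact Subgroup.subset_closure (Or.inl ⟨a, ha, rfl⟩)
    · exact Subgroup.subset_closure (Or.inr ⟨b, hb, rfl⟩)
    · induction hE using Subgroup.closure_induction with
      | mem E hE =>
        rcases hE with ⟨a, ha, rfl⟩ | ⟨b, hb, rfl⟩
        · exact h.1 a ha
        · exact h.2 b hb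
      | one => rfl
      | mul E E' _ _ hE hE' => 
        change E (E' v) = v
        rw [hE', hE]
      | inv E _ hE =>
        change E.symm v = v
        rw [LinearIsometryEquiv.symm_apply_eq, hE]
  rw [h1]
  refine and_congr (forall₂_congr fun a _ => ⟨fun h x => ?_, fun h => ?_⟩)
    ⟨fun h x hx => ?_, fun h b hb => ?_⟩
  · rw [← congrArg (fun w : QuditSpace F n => w (x + a)) h, xOp_apply, add_sub_cancel_right]
  · ext x
    rw [xOp_apply, ← h (x - a), sub_add_cancel]
  · by_contra hv
    refine hx (dualCode_dualCode C ▸ mem_dualCode_iff_primeTrace.2 fun b hb => ?_)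
    have h2 := congrArg (fun w : QuditSpace F n => w x) (h b hb)
    simp only [zOp_apply] at h2
    exact coe_toCircle_eq_one_iff.1 (mul_eq_right₀ hv |>.1 h2)
  · ext x
    rw [zOp_apply]
    by_cases hx : x ∈ C
    · rw [dotProduct_comm, hb x hx, map_zero, AddChar.map_zero_eq_one, Circle.coe_one, one_mul]
    · rw [h x hx, mul_zero]

/-- A state of the CSS code is an arbitrary function on the cosets of `C^⊥` in `C`. -/
theorem finrank_fixedSpace_cssGroup {C : Submodule F (Fin n → F)} (hC : dualCode C ≤ C) :
    Module.finrank ℂ (fixedSpace (cssGroup C)) =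
      Fintype.card F ^ (Module.finrank F C - Module.finrank F (dualCode C)) := by
  classical
  set D' := (dualCode C).submoduleOf C with hD'
  have : Fintype (C ⧸ D') := Fintype.ofFinite _
  let f : ((C ⧸ D') → ℂ) →ₗ[ℂ] QuditSpace F n :=
    { toFun := fun g => WithLp.toLp 2 fun x => if h : x ∈ C then g (D'.mkQ ⟨x, h⟩) else 0
      map_add' := fun g g' => by
        ext x
        by_cases h : x ∈ C <;> simp [h]
      map_smul' := fun c g => by
        ext x
        by_cases h : x ∈ C <;> simp [h] }
  have hf : ∀ g x, f g x = if h : x ∈ C then g (D'.mkQ ⟨x, h⟩) else 0 := fun _ _ => rfl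
  have hinj : Function.Injective f := by
    intro g g' hgg
    ext c
    obtain ⟨x, rfl⟩ := D'.mkQ_surjective c
    have h := congrArg (fun w : QuditSpace F n => w x) hgg
    simpa only [hf, dif_pos x.2] using h
  have hrange : LinearMap.range f = fixedSpace (cssGroup C) := by
    ext v
    rw [mem_fixedSpace_cssGroup]
    constructor
    · rintro ⟨g, rfl⟩
      refine ⟨fun a ha x => ?_, fun x hx => by rw [hf, dif_neg hx]⟩
      rw [hf, hf]
      by_cases hx : x ∈ C
      · rw [dif_pos hx, dif_pos (C.add_mem hx (hC ha))]
        congr 1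
        refine (Submodule.Quotient.eq D').2 ?_
        change x + a - x ∈ dualCode C
        rwa [add_sub_cancel_left]
      · rw [dif_neg hx, dif_neg fun h => hx (by simpa using C.sub_mem h (hC ha))]
    · rintro ⟨h1, h2⟩
      refine ⟨fun c => v (Quotient.out c : C), ?_⟩
      ext x
      rw [hf]
      split_ifs with hx
      · have h3 : D'.mkQ (Quotient.out (D'.mkQ ⟨x, hx⟩)) = D'.mkQ ⟨x, hx⟩ := Quotient.out_eq _
        have h4 : (Quotient.out (D'.mkQ ⟨x, hx⟩) : C).1 - x ∈ dualCode C :=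
          (Submodule.Quotient.eq D').1 h3
        rw [← h1 _ h4 x, add_sub_cancel]
      · exact (h2 x hx).symm
  have h1 := D'.finrank_quotient_add_finrank
  rw [LinearEquiv.finrank_eq (Submodule.submoduleOfEquivOfLe hC)] at h1
  rw [← hrange, LinearMap.finrank_range_of_inj hinj, Module.finrank_fintype_fun_eq_card,
    Module.card_eq_pow_finrank (K := F), ← h1, Nat.add_sub_cancel]

open Classical in
/-- The unnormalized state `∑ |y⟩`, summed over the coset `x + C^⊥`. -/
noncomputable def cosetState (C : Submodule F (Fin n → F)) (x : Fin n → F) : QuditSpace F n :=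
  WithLp.toLp 2 fun y => if y - x ∈ dualCode C then 1 else 0

open Classical in
theorem cosetState_apply (C : Submodule F (Fin n → F)) (x y : Fin n → F) :
    cosetState C x y = if y - x ∈ dualCode C then 1 else 0 := rfl

theorem cosetState_mem {C : Submodule F (Fin n → F)} (hC : dualCode C ≤ C) {x : Fin n → F}
    (hx : x ∈ C) : cosetState C x ∈ fixedSpace (cssGroup C) := by
  refine mem_fixedSpace_cssGroup.2 ⟨fun a ha y => ?_, fun y hy => ?_⟩
  · rw [cosetState_apply, cosetState_apply, add_sub_right_comm, Submodule.add_mem_iff_left _ ha]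
  · rw [cosetState_apply, if_neg fun h => hy (by simpa using C.add_mem (hC h) hx)]

theorem mem_dualCode_of_mem_stabilizerGroup {C : Submodule F (Fin n → F)} (hC : dualCode C ≤ C)
    {c : ZMod (ringChar F)} {a b : Fin n → F}
    (h : errorOp c a b ∈ stabilizerGroup (fixedSpace (cssGroup C))) :
    a ∈ dualCode C ∧ b ∈ dualCode C := by
  have hx : ∀ x ∈ C, ∀ y, errorOp c a b (cosetState C x) y = cosetState C x y := fun x hx y => by
    rw [h.2 _ (cosetState_mem hC hx)]
  simp only [errorOp_apply, cosetState_apply] at hx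
  have ha : a ∈ dualCode C := by
    by_contra ha
    have h0 := hx 0 C.zero_mem a
    simp [ha] at h0
  have hphase : ∀ x ∈ C, c + primeTrace F (b ⬝ᵥ (x - a)) = 0 := fun x hxC => by
    have h1 := hx x hxC x
    rw [if_pos (by rw [sub_sub_cancel_left]; exact neg_mem ha), if_pos (by simp), mul_one,
      ← Circle.coe_mul, ← AddChar.map_add_eq_mul] at h1
    exact coe_toCircle_eq_one_iff.1 h1
  refine ⟨ha, mem_dualCode_iff_primeTrace.2 fun x hxC => ?_⟩
  have h1 := hphase (x + a) (C.add_mem hxC (hC ha))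
  have h2 := hphase a (hC ha)
  rw [sub_self, dotProduct_zero, map_zero, add_zero] at h2
  rwa [add_sub_cancel_right, h2, zero_add, dotProduct_comm] at h1

/-- An error `X(a) Z(b)` that is not detected has `a, b ∈ C`, but not both of them in `C^⊥`:
if `a ∉ C`, the code is mapped to states with disjoint support; if `b ∉ C`, it is mapped to
states with a nontrivial character under translation by `C^⊥`; in both cases all matrix elements
between code states vanish. If `a, b ∈ C^⊥`, the error acts as a scalar. -/
theorem mem_of_not_detects {C : Submodule F (Fin n → F)}
    {c : ZMod (ringChar F)} {a b : Fin n → F}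
    (h : ¬ Detects (fixedSpace (cssGroup C)) (errorOp c a b)) :
    a ∈ C ∧ b ∈ C ∧ ¬ (a ∈ dualCode C ∧ b ∈ dualCode C) := by
  refine ⟨?_, ?_, ?_⟩
  · by_contra ha
    refine h ⟨0, fun u hu v hv => ?_⟩
    rw [mem_fixedSpace_cssGroup] at hu hv
    rw [zero_mul, PiLp.inner_apply]
    refine Finset.sum_eq_zero fun x _ => ?_
    by_cases hx : x ∈ C
    · rw [errorOp_apply, hv.2 (x - a) fun hxa => ha (by simpa using C.sub_mem hx hxa), mul_zero,
        inner_zero_right]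
    · rw [hu.2 x hx, inner_zero_left]
  · by_contra hb
    refine h ⟨0, fun u hu v hv => ?_⟩
    rw [mem_fixedSpace_cssGroup] at hu hv
    rw [← dualCode_dualCode C, mem_dualCode_iff_primeTrace] at hb
    push Not at hb
    obtain ⟨d, hd, hdb⟩ := hb
    have hE : ∀ x, errorOp c a b v (x + d) =
        ZMod.toCircle (primeTrace F (d ⬝ᵥ b)) * errorOp c a b v x := fun x => by
      rw [errorOp_apply, errorOp_apply, add_sub_right_comm, hv.1 d hd, dotProduct_add, map_add,
        AddChar.map_add_eq_mul, Circle.coe_mul, dotProduct_comm d]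
      ring
    have hI : inner ℂ u (errorOp c a b v) =
        ZMod.toCircle (primeTrace F (d ⬝ᵥ b)) * inner ℂ u (errorOp c a b v) := by
      conv_lhs => rw [PiLp.inner_apply, ← Equiv.sum_comp (Equiv.addRight d)]
      simp only [Equiv.coe_addRight, hE, hu.1 d hd]
      rw [PiLp.inner_apply, Finset.mul_sum]
      refine Finset.sum_congr rfl fun x _ => ?_
      rw [← smul_eq_mul, inner_smul_right]
    rw [zero_mul]
    by_contra h0
    exact hdb (coe_toCircle_eq_one_iff.1 (mul_eq_right₀ h0 |>.1 hI.symm))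
  · rintro ⟨ha, hb⟩
    refine h ⟨ZMod.toCircle c, fun u hu v hv => ?_⟩
    rw [mem_fixedSpace_cssGroup] at hu hv
    have hE : errorOp c a b v = (ZMod.toCircle c : ℂ) • v := by
      ext x
      have h1 : v (x - a) = v x := by rw [← hv.1 a ha, sub_add_cancel]
      rw [errorOp_apply, PiLp.smul_apply, smul_eq_mul]
      by_cases hx : x - a ∈ C
      · rw [dotProduct_comm, hb _ hx, map_zero, AddChar.map_zero_eq_one, Circle.coe_one, mul_one,
          h1]
      · rw [← h1, hv.2 _ hx, mul_zero, mul_zero]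
    rw [hE, inner_smul_right]

/-- For `a ∈ C` outside `C^⊥`, the operator `X(a)` permutes the cosets of `C^⊥` in `C` without fixed
points, so it is not detected. -/
theorem not_detects_errorOp {C : Submodule F (Fin n → F)} (hC : dualCode C ≤ C) {a : Fin n → F}
    (ha : a ∈ C) (ha' : a ∉ dualCode C) :
    ¬ Detects (fixedSpace (cssGroup C)) (errorOp 0 a 0) := by
  rintro ⟨μ, hμ⟩
  have hE : errorOp 0 a 0 (cosetState C 0) = cosetState C a := by
    ext x
    rw [errorOp_eq_xOp, xOp_apply, cosetState_apply, cosetState_apply, sub_zero]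
  have horth : inner ℂ (cosetState C 0) (cosetState C a) = 0 := by
    rw [PiLp.inner_apply]
    refine Finset.sum_eq_zero fun x _ => ?_
    rw [cosetState_apply, cosetState_apply, sub_zero]
    by_cases hx : x ∈ dualCode C
    · rw [if_neg fun h => ha' ((Submodule.sub_mem_iff_right _ hx).1 h), inner_zero_right]
    · rw [if_neg hx, inner_zero_left]
  have hne : ∀ x, cosetState C x ≠ 0 := fun x h => by
    have h1 := congrArg (fun w : QuditSpace F n => w x) h
    simp [cosetState_apply] at h1
  have h0 := cosetState_mem hC C.zero_mem
  have h1 := hμ _ h0 _ h0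
  have h2 := hμ _ (cosetState_mem hC ha) _ h0
  rw [hE, horth, eq_comm, mul_eq_zero, or_iff_left (inner_self_ne_zero.2 (hne 0))] at h1
  rw [hE, h1, zero_mul] at h2
  exact inner_self_ne_zero.2 (hne a) h2

variable [DecidableEq F]

/-- The minimum distance of a CSS code is at least that of the classical code. -/
theorem le_errorWeight_of_not_detects {C : Submodule F (Fin n → F)} {t : ℕ}
    (ht : ∀ x ∈ C, x ≠ 0 → t ≤ hammingNorm x) {c : ZMod (ringChar F)} {a b : Fin n → F}
    (h : ¬ Detects (fixedSpace (cssGroup C)) (errorOp c a b)) : t ≤ errorWeight a b := by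
  obtain ⟨ha, hb, hab⟩ := mem_of_not_detects h
  refine le_errorWeight ht ha hb ?_
  by_contra! h0
  exact hab (by simp [h0.1, h0.2])

/-- A CSS code is pure to any lower bound on the weights of the nonzero words of `C^⊥`. -/
theorem pureTo_fixedSpace_cssGroup {C : Submodule F (Fin n → F)} (hC : dualCode C ≤ C) {t : ℕ}
    (ht : ∀ x ∈ dualCode C, x ≠ 0 → t ≤ hammingNorm x) : PureTo (fixedSpace (cssGroup C)) t :=
  fun _ _ _ h hab =>
    le_errorWeight ht (mem_dualCode_of_mem_stabilizerGroup hC h).1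
      (mem_dualCode_of_mem_stabilizerGroup hC h).2 hab

end css

/-! ### Parameters of the quantum BCH code -/

theorem mainTheorem7 {F K : Type*} [Field F] [Fintype F] [DecidableEq F] [Field K] [Algebra F K]
    (q m δ : ℕ) (hq : Fintype.card F = q) (hm : 2 ≤ m) (hK : Module.finrank F K = m)
    (α : K) (hα : IsPrimitiveRoot α (q ^ m - 1))
    (hδ : 2 ≤ δ) (hδmax : δ ≤ deltaMax q m) :
    ∃ (Q : Submodule ℂ (QuditSpace F (q ^ m - 1))) (k dQ : ℕ),
      (k : ℤ) = (q : ℤ) ^ m - 1 - 2 * m * ⌈((δ : ℚ) - 1) * (1 - 1 / (q : ℚ))⌉ ∧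
      IsStabilizerCodeWith Q k dQ ∧
      δ ≤ dQ ∧
      IsCSSCodeOf Q (bchCode F q m δ α) ∧
      PureTo Q (deltaMax q m + 1) ∧
      ∀ d : ℕ, IsMinDistance (bchCode F q m δ α) d → d ≤ deltaMax q m →
        IsPure Q ∧ dQ = d := by
  have : FiniteDimensional F K := Module.finite_of_finrank_pos (by omega)
  set C := bchCode F q m δ α
  have hC : dualCode C ≤ C := dualCode_bchCode_le hq hm hK hα hδmax
  set Q := fixedSpace (cssGroup C) with hQ
  have hfin := finrank_fixedSpace_cssGroup hC
  have hdual := finrank_add_finrank_dualCode C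
  have hdim := finrank_bchCode_add hq hm hK hα hδmax
  have hle := Submodule.finrank_mono hC
  set k := Module.finrank F C - Module.finrank F (dualCode C) with hk
  have hpure : PureTo Q (deltaMax q m + 1) := pureTo_fixedSpace_cssGroup hC fun x hx hx0 =>
    deltaMax_lt_hammingNorm_of_mem_dualCode hq hm hK hα hδmax hx hx0
  set W := {w : ℕ | ∃ c a b, errorWeight a b = w ∧ ¬ Detects Q (errorOp c a b)}
  have hmem : ∀ x ∈ C, x ∉ dualCode C → hammingNorm x ∈ W := fun x hx hx' =>
    ⟨0, x, 0, errorWeight_zero_right x, not_detects_errorOp hC hx hx'⟩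
  have hlower : ∀ t, (∀ x ∈ C, x ≠ 0 → t ≤ hammingNorm x) → ∀ w ∈ W, t ≤ w := by
    rintro t ht _ ⟨c, a, b, rfl, h⟩
    exact le_errorWeight_of_not_detects ht h
  have hne : W.Nonempty :=
    ⟨_, hmem 1 (one_mem_bchCode hq hm hα hδmax) (one_notMem_dualCode_bchCode hq hm hα hδmax)⟩
  have hleast : IsLeast W (sInf W) := ⟨Nat.sInf_mem hne, fun w hw => Nat.sInf_le hw⟩
  refine ⟨Q, k, sInf W, ?_, ⟨⟨?_, cssGroup C, cssGroup_le_errorGroup C, hQ⟩, hfin, hleast⟩,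
    hlower δ (fun x hx hx0 => le_hammingNorm_of_mem_bchCode hq (by omega) hα hx hx0) _ hleast.1,
    ⟨hC, rfl⟩, hpure, fun d hd hdmax => ?_⟩
  · have hq1 : 1 ≤ q ^ m := Nat.one_le_pow _ _ (hq ▸ Fintype.card_pos)
    rw [← card_filter_not_dvd (by omega), hk, Nat.cast_sub hle]
    have h1 : ((q ^ m - 1 : ℕ) : ℤ) = (q : ℤ) ^ m - 1 := by push_cast [hq1]; rfl
    have h2 := congrArg (Nat.cast : ℕ → ℤ) hdual
    have h3 := congrArg (Nat.cast : ℕ → ℤ) hdim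
    rw [h1] at h2 h3
    push_cast at h2 h3
    linarith
  · intro hbot
    rw [← hQ, hbot, finrank_bot] at hfin
    exact pow_ne_zero k Fintype.card_ne_zero hfin.symm
  · have hd1 : ∀ x ∈ C, x ≠ 0 → d ≤ hammingNorm x := fun x hx hx0 =>
      hd.2 ⟨x, hx, 0, C.zero_mem, hx0, hammingDist_zero_right x⟩
    obtain ⟨x, hx, y, hy, hxy, hdxy⟩ := hd.1
    rw [hammingDist_eq_hammingNorm] at hdxy
    -- a word of weight `d ≤ δ_max` in `C` is too light to lie in the dual code
    have hnot : -x + y ∉ dualCode C := fun h => by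
      have := deltaMax_lt_hammingNorm_of_mem_dualCode hq hm hK hα hδmax h
        (neg_add_eq_zero.not.2 hxy)
      omega
    have heq : sInf W = d := le_antisymm
      (Nat.sInf_le (hdxy ▸ hmem _ (C.add_mem (C.neg_mem hx) hy) hnot)) (hlower d hd1 _ hleast.1)
    exact ⟨⟨sInf W, hleast, fun c a b h hab => by have := hpure c a b h hab; omega⟩, heq⟩
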